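/- Let $G$ be a countable discrete group acting on $\ell^\infty(G)$ by left translation, $(t.f)(s)=f(t^{-1}s)$, and let $N$ be a countable subset of $\ell^\infty(G)$. Then there exists a separable $G$-invariant sub-$C^*$-algebra $A$ of $\ell^\infty(G)$ (not required to be unital) such that 1. $N\subseteq A$ and $A$ is generated, as a $C^*$-algebra, by its projections; 2. for every projection $p\in A$, if $p$ is properly infinite in the reduced crossed product $\ell^\infty(G)\rtimes_r G$, then $p$ is properly infinite in the reduced crossed product $A\rtimes_r G$. Here a positive element $a$ of a $C^*$-algebra $D$ is called properly infinite (in $D$) if $a\neq 0$ and $a\oplus a\precsim a$, i.e. there is a sequence $(r_n)$ in $M_{1,2}(D)$ with $r_n^*\,a\,r_n\to \mathrm{diag}(a,a)$ in $M_2(D)$. For a $G$-invariant sub-$C^*$-algebra $B\subseteq\ell^\infty(G)$, $B\rtimes_r G$ is the $C^*$-algebra associated with the regular representation, generated by the operators $b\lambda_s$ ($b\in B$, $s\in G$) on $\ell^2(G,H)$, where $B$ is faithfully represented by $\pi$ on a Hilbert space $H$, $(b\xi)(t)=\pi(t^{-1}.b)\xi(t)$ and $(\lambda_s\xi)(t)=\xi(s^{-1}t)$;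 $B$ is regarded as a subalgebra of $B\rtimes_r G$. -/

import Mathlib

open scoped ENNReal lp Topology Matrix

noncomputable section

namespace CrossedProducts

/-! ### Cuntz comparison and properly infinite elements -/

section Cuntz

variable {D : Type*} [NonUnitalRing D] [StarRing D] [TopologicalSpace D]

/-- Cuntz comparison `a ≾ b` for (positive) square matrices `a`, `b` over `D`, possibly of
different sizes: there are rectangular matrices `r k` over `D` with `(r k)ᴴ * b * r k → a`. The
topology on matrices is that of entrywise convergence, i.e. the C⋆-norm topology. -/
def CuntzLE {m n : Type*} [Fintype m] [Fintype n] (a : Matrix n n D) (b : Matrix m m D) : Prop :=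
  ∃ r : ℕ → Matrix m n D, Filter.Tendsto (fun k => (r k)ᴴ * b * r k) Filter.atTop (𝓝 a)

/-- A (positive) element `a` of a C⋆-algebra `D` is properly infinite if it is nonzero and
`a ⊕ a ≾ a`, where `a ⊕ a = diag(a, a)`. -/
def IsProperlyInfinite (a : D) : Prop :=
  a ≠ 0 ∧ CuntzLE !![a, 0; 0, a] !![a]

end Cuntz

/-! ### Reduced crossed products -/

section CrossedProduct

variable {G : Type*} [Group G]
variable {H : Type*} [NormedAddCommGroup H] [InnerProductSpace ℂ H]

/-- The left translation `(λ_s ξ)(t) = ξ(s⁻¹ t)` on `ℓ²(G, H)`. -/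
def translate (s : G) : ℓ²(G, H) →ₗᵢ[ℂ] ℓ²(G, H) where
  toFun ξ := ⟨fun t => ξ (s⁻¹ * t), by
    have h : Summable fun t => ‖ξ t‖ ^ (2 : ℝ≥0∞).toReal := (lp.memℓp ξ).summable (by norm_num)
    exact memℓp_gen (h.comp_injective (mul_right_injective s⁻¹))⟩
  map_add' _ _ := rfl
  map_smul' _ _ := rfl
  norm_map' ξ := by
    have h2 : 0 < (2 : ℝ≥0∞).toReal := by norm_num
    rw [lp.norm_eq_tsum_rpow h2, lp.norm_eq_tsum_rpow h2 ξ]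
    congr 1
    exact (Equiv.mulLeft s⁻¹).tsum_eq (fun t => ‖ξ t‖ ^ (2 : ℝ≥0∞).toReal)

@[simp] lemma translate_apply (s : G) (ξ : ℓ²(G, H)) (t : G) :
    translate s ξ t = ξ (s⁻¹ * t) := rfl

variable [CompleteSpace H]
variable {A : Type*} [NonUnitalCStarAlgebra A]

lemma norm_rep_le (α : G →* (A ≃⋆ₐ[ℂ] A)) (π : A →⋆ₙₐ[ℂ] (H →L[ℂ] H)) (a : A) (t : G) :
    ‖π (α t⁻¹ a)‖ ≤ ‖a‖ :=
  (NonUnitalStarAlgHom.norm_apply_le π _).trans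
    (NonUnitalStarAlgHom.norm_apply_le (α t⁻¹) a)

/-- For a C⋆-dynamical system `(A, G, α)` and a representation `π` of `A` on `H`, the
representation of `A` on `ℓ²(G, H)` given by `(a ξ)(t) = π(α_{t⁻¹}(a)) ξ(t)`. -/
def regularRep (α : G →* (A ≃⋆ₐ[ℂ] A)) (π : A →⋆ₙₐ[ℂ] (H →L[ℂ] H)) :
    A →⋆ₙₐ[ℂ] (ℓ²(G, H) →L[ℂ] ℓ²(G, H)) where
  toFun a := lp.mapCLM 2 (fun t => π (α t⁻¹ a)) (norm_nonneg a) (norm_rep_le α π a)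
  map_smul' c a := by ext ξ t; simp
  map_zero' := by ext ξ t; simp
  map_add' a b := by ext ξ t; simp
  map_mul' a b := by ext ξ t; simp
  map_star' a := by
    rw [ContinuousLinearMap.star_eq_adjoint, ContinuousLinearMap.eq_adjoint_iff]
    intro ξ η
    rw [lp.inner_eq_tsum, lp.inner_eq_tsum]
    congr 1
    ext t
    simp [map_star, ContinuousLinearMap.star_eq_adjoint, ContinuousLinearMap.adjoint_inner_left]

@[simp] lemma regularRep_apply (α : G →* (A ≃⋆ₐ[ℂ] A)) (π : A →⋆ₙₐ[ℂ] (H →L[ℂ] H)) (a : A)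
    (ξ : ℓ²(G, H)) (t : G) : regularRep α π a ξ t = π (α t⁻¹ a) (ξ t) := rfl

/-- The reduced crossed product `A ⋊_r G` of a C⋆-dynamical system `(A, G, α)`, `G` discrete,
formed with a faithful representation `π` of `A` on `H`: the C⋆-algebra of operators on `ℓ²(G, H)`
generated by the elements `a λ_s`, `a ∈ A`, `s ∈ G`. (Up to canonical isomorphism it does not
depend on the choice of the faithful representation.) -/
def reducedCrossedProduct (α : G →* (A ≃⋆ₐ[ℂ] A)) (π : A →⋆ₙₐ[ℂ] (H →L[ℂ] H)) :
    NonUnitalStarSubalgebra ℂ (ℓ²(G, H) →L[ℂ] ℓ²(G, H)) :=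
  (NonUnitalStarAlgebra.adjoin ℂ
    {T | ∃ (a : A) (s : G),
      T = regularRep α π a * (translate s).toContinuousLinearMap}).topologicalClosure

lemma regularRep_mem (α : G →* (A ≃⋆ₐ[ℂ] A)) (π : A →⋆ₙₐ[ℂ] (H →L[ℂ] H)) (a : A) :
    regularRep α π a ∈ reducedCrossedProduct α π := by
  refine NonUnitalStarSubalgebra.le_topologicalClosure _
    (NonUnitalStarAlgebra.subset_adjoin ℂ _ ⟨a, 1, ?_⟩)
  ext ξ t
  simp

/-- The canonical inclusion `A → A ⋊_r G`. -/
def inclusion (α : G →* (A ≃⋆ₐ[ℂ] A)) (π : A →⋆ₙₐ[ℂ] (H →L[ℂ] H)) :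
    A →⋆ₙₐ[ℂ] reducedCrossedProduct α π :=
  NonUnitalStarAlgHom.codRestrict (regularRep α π) _ (regularRep_mem α π)

end CrossedProduct

/-! ### Invariant sub-C⋆-algebras -/

section Invariant

variable {G : Type*} [Group G] {B : Type*} [NonUnitalCStarAlgebra B]

/-- A (not necessarily unital) sub-C⋆-algebra of `B` that is invariant under the action `α`. -/
structure InvariantSubalgebra (α : G →* (B ≃⋆ₐ[ℂ] B)) extends NonUnitalStarSubalgebra ℂ B where
  isClosed' : IsClosed carrier
  map_mem' : ∀ (t : G) {b : B}, b ∈ carrier → α t b ∈ carrier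

namespace InvariantSubalgebra

variable {α : G →* (B ≃⋆ₐ[ℂ] B)} (A : InvariantSubalgebra α)

instance : NonUnitalCStarAlgebra A.toNonUnitalStarSubalgebra :=
  NonUnitalStarSubalgebra.nonUnitalCStarAlgebra _ (h_closed := A.isClosed')

/-- The action of `G` on an invariant sub-C⋆-algebra. -/
def action : G →* (A.toNonUnitalStarSubalgebra ≃⋆ₐ[ℂ] A.toNonUnitalStarSubalgebra) where
  toFun t :=
    { toFun := fun a => ⟨α t a, A.map_mem' t a.2⟩
      invFun := fun a => ⟨α t⁻¹ a, A.map_mem' t⁻¹ a.2⟩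
      left_inv := fun a => Subtype.ext (by
        change (α t⁻¹ * α t) (a : B) = a
        rw [← map_mul, inv_mul_cancel, map_one]; rfl)
      right_inv := fun a => Subtype.ext (by
        change (α t * α t⁻¹) (a : B) = a
        rw [← map_mul, mul_inv_cancel, map_one]; rfl)
      map_mul' := fun a b => Subtype.ext (map_mul (α t) (a : B) b)
      map_add' := fun a b => Subtype.ext (map_add (α t) (a : B) b)
      map_star' := fun a => Subtype.ext (map_star (α t) (a : B))
      map_smul' := fun c a => Subtype.ext (map_smul (α t) c (a : B)) }
  map_one' := by ext a; simp
  map_mul' s t := by ext a; simp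

/-- The restriction to `A` of a representation of `B`. -/
def restrictRep {H : Type*} [NormedAddCommGroup H] [InnerProductSpace ℂ H] [CompleteSpace H]
    (π : B →⋆ₙₐ[ℂ] (H →L[ℂ] H)) : A.toNonUnitalStarSubalgebra →⋆ₙₐ[ℂ] (H →L[ℂ] H) :=
  π.comp (NonUnitalStarSubalgebraClass.subtype _)

/-- `A` is generated, as a C⋆-algebra, by its projections. -/
def IsGeneratedByProjections : Prop :=
  (NonUnitalStarAlgebra.adjoin ℂ
    {p : B | p ∈ A.toNonUnitalStarSubalgebra ∧ IsStarProjection p}).topologicalClosure =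
      A.toNonUnitalStarSubalgebra

end InvariantSubalgebra

end Invariant

/-! ### The action of `G` on `ℓ^∞(G)` -/

section Linfty

/-- The action of `G` on `ℓ^∞(G)` by left translation, `(t.f)(s) = f(t⁻¹ s)`. -/
def leftTranslation (G : Type*) [Group G] : G →* (ℓ^∞(G, ℂ) ≃⋆ₐ[ℂ] ℓ^∞(G, ℂ)) where
  toFun t :=
    { toFun := fun f => ⟨fun s => f (t⁻¹ * s), memℓp_infty ((lp.memℓp f).bddAbove.mono (by
        rintro _ ⟨s, rfl⟩; exact ⟨t⁻¹ * s, rfl⟩))⟩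
      invFun := fun f => ⟨fun s => f (t * s), memℓp_infty ((lp.memℓp f).bddAbove.mono (by
        rintro _ ⟨s, rfl⟩; exact ⟨t * s, rfl⟩))⟩
      left_inv := fun f => by ext s; simp
      right_inv := fun f => by ext s; simp
      map_mul' := fun f g => rfl
      map_add' := fun f g => rfl
      map_star' := fun f => rfl
      map_smul' := fun c f => rfl }
  map_one' := by ext f s; simp
  map_mul' s t := by
    ext f r
    change f ((s * t)⁻¹ * r) = f (t⁻¹ * (s⁻¹ * r))
    rw [mul_inv_rev, mul_assoc]

/-- The representation of `ℓ^∞(G)` on `ℓ²(G)` by multiplication operators. -/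
def mulRep (G : Type*) : ℓ^∞(G, ℂ) →⋆ₙₐ[ℂ] (ℓ²(G, ℂ) →L[ℂ] ℓ²(G, ℂ)) where
  toFun f := lp.mapCLM 2 (fun s => f s • ContinuousLinearMap.id ℂ ℂ) (norm_nonneg f)
    (fun s => by simpa [norm_smul] using lp.norm_apply_le_norm ENNReal.top_ne_zero f s)
  map_smul' c f := by ext ξ t; simp [mul_assoc]
  map_zero' := by ext ξ t; simp
  map_add' f g := by ext ξ t; simp [add_mul]
  map_mul' f g := by ext ξ t; simp [mul_assoc]
  map_star' f := by
    rw [ContinuousLinearMap.star_eq_adjoint, ContinuousLinearMap.eq_adjoint_iff]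
    intro ξ η
    rw [lp.inner_eq_tsum, lp.inner_eq_tsum]
    congr 1
    ext t
    simp [mul_comm, mul_assoc, mul_left_comm]

@[simp] lemma mulRep_apply (G : Type*) (f : ℓ^∞(G, ℂ)) (ξ : ℓ²(G, ℂ)) (s : G) :
    mulRep G f ξ s = f s * ξ s := rfl

lemma mulRep_injective (G : Type*) : Function.Injective (mulRep G) := by
  classical
  intro f g h
  ext s
  have := congrArg (fun T : ℓ²(G, ℂ) →L[ℂ] ℓ²(G, ℂ) => T (lp.single 2 s 1) s) h
  simpa using this

end Linfty

end CrossedProducts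

end

open CrossedProducts Filter

/-! The algebra `A` is the closure of a countable set `S` that contains `N` and is saturated under
every operation the conclusion needs: the algebraic operations, scalars from a countable dense
subset of ℂ, the action of `G`, indicators of the level bands of each `x ∈ S`, and a countable set
`W x` of coefficients. Countability of `S` makes `A` separable.

The bands serve twice. Rounding real and imaginary parts approximates each `x ∈ S` uniformly by
combinations of its band indicators, so the projections generate `A`
(`mem_of_preimageIndicator_mem`). Moreover a projection within 1/2 of some `f ∈ S` is itself a band
indicator of `f`, so every projection of `A` already lies in `S`
(`preimageIndicator_eq_of_norm_sub_lt`). Hence its set `W p` lies in `A` too.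

If `p` is properly infinite in the large crossed product, `W p` collects the coefficients of finite
expressions approximating the comparison matrices. Once these lie in `A`, the same matrices live in
the crossed product by `A` (`exists_countable_isProperlyInfinite`). -/

/-- A countable set is contained in a countable set that is closed under a countably-valued
binary operation. -/
theorem Set.Countable.exists_closed_superset {X : Type*} {S : Set X} (hS : S.Countable)
    (Φ : X → X → Set X) (hΦ : ∀ x y, (Φ x y).Countable) :
    ∃ T : Set X, S ⊆ T ∧ T.Countable ∧ ∀ x ∈ T, ∀ y ∈ T, Φ x y ⊆ T := by
  let U : ℕ → Set X := fun n => Nat.rec S (fun _ V => V ∪ ⋃ x ∈ V, ⋃ y ∈ V, Φ x y) n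
  have hsucc : ∀ n, U (n + 1) = U n ∪ ⋃ x ∈ U n, ⋃ y ∈ U n, Φ x y := fun _ => rfl
  have hmono : Monotone U := monotone_nat_of_le_succ fun n => by
    rw [hsucc]; exact Set.subset_union_left
  have hcount : ∀ n, (U n).Countable := fun n => by
    induction n with
    | zero => exact hS
    | succ n ih =>
      rw [hsucc]
      exact ih.union (ih.biUnion fun x _ => ih.biUnion fun y _ => hΦ x y)
  refine ⟨⋃ n, U n, Set.subset_iUnion U 0, Set.countable_iUnion hcount, ?_⟩
  intro x hx y hy z hz
  obtain ⟨m, hm⟩ := Set.mem_iUnion.1 hx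
  obtain ⟨n, hn⟩ := Set.mem_iUnion.1 hy
  refine Set.mem_iUnion.2 ⟨max m n + 1, ?_⟩
  rw [hsucc]
  exact Or.inr (Set.mem_biUnion (hmono (le_max_left m n) hm)
    (Set.mem_biUnion (hmono (le_max_right m n) hn) hz))

namespace CrossedProducts

/-! ### Proper infiniteness in subalgebras -/

section Cuntz

/-- Proper infiniteness descends along an inducing map that respects the operations and whose range
contains the entries of the comparison matrices. -/
theorem IsProperlyInfinite.of_map {D E : Type*} [NonUnitalRing D] [StarRing D] [TopologicalSpace D]
    [NonUnitalRing E] [StarRing E] [TopologicalSpace E] (φ : D → E) (hφ : Topology.IsInducing φ)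
    (hzero : φ 0 = 0) (hmul : ∀ x y, φ (x * y) = φ x * φ y) (hstar : ∀ x, φ (star x) = star (φ x))
    {a : D} (ha : φ a ≠ 0) {r : ℕ → Matrix (Fin 1) (Fin 2) E}
    (hr : ∀ k i j, r k i j ∈ Set.range φ)
    (hlim : Tendsto (fun k => (r k)ᴴ * !![φ a] * r k) atTop (𝓝 !![φ a, 0; 0, φ a])) :
    IsProperlyInfinite a := by
  choose q hq using hr
  refine ⟨fun h => ha (by rw [h, hzero]), fun k => Matrix.of (q k), ?_⟩
  have hlim' := fun i j => tendsto_pi_nhds.1 (tendsto_pi_nhds.1 hlim i) j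
  refine tendsto_pi_nhds.2 fun i => tendsto_pi_nhds.2 fun j => hφ.tendsto_nhds_iff.2 ?_
  convert hlim' i j using 1
  · ext k
    simp [Matrix.mul_apply, hmul, hstar, hq]
  · congr 1
    fin_cases i <;> fin_cases j <;> simp [hzero]

end Cuntz

/-! ### Crossed products by invariant subalgebras -/

section Invariant

variable {G : Type*} [Group G] {B : Type*} [NonUnitalCStarAlgebra B]
  {H : Type*} [NormedAddCommGroup H] [InnerProductSpace ℂ H] [CompleteSpace H]
  {α : G →* (B ≃⋆ₐ[ℂ] B)}

/-- Both algebras act on the same space ℓ²(G, H), so generators of the smaller one are literally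
generators of the larger one, and the inclusion is a topological embedding. -/
theorem InvariantSubalgebra.reducedCrossedProduct_le (A : InvariantSubalgebra α)
    (π : B →⋆ₙₐ[ℂ] (H →L[ℂ] H)) :
    reducedCrossedProduct A.action (A.restrictRep π) ≤ reducedCrossedProduct α π := by
  refine NonUnitalStarSubalgebra.topologicalClosure_mono (NonUnitalStarAlgebra.adjoin_mono ?_)
  rintro _ ⟨a, s, rfl⟩
  exact ⟨a, s, rfl⟩

/-- Every element of a reduced crossed product has a countable support in the coefficient
algebra. -/
theorem exists_countable_support (π : B →⋆ₙₐ[ℂ] (H →L[ℂ] H)) {T : ℓ²(G, H) →L[ℂ] ℓ²(G, H)}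
    (hT : T ∈ reducedCrossedProduct α π) :
    ∃ W : Set B, W.Countable ∧ ∀ A : InvariantSubalgebra α,
      W ⊆ (A.toNonUnitalStarSubalgebra : Set B) →
        T ∈ reducedCrossedProduct A.action (A.restrictRep π) := by
  -- A sequence of algebraic elements suffices by metrizability. Each involves finitely many
  -- coefficients, and the limit stays in the closed crossed product by `A`.
  obtain ⟨u, hu, hlim⟩ := mem_closure_iff_seq_limit.1 hT
  suffices h : ∀ n, ∃ W : Set B, W.Countable ∧ ∀ A : InvariantSubalgebra α,
      W ⊆ (A.toNonUnitalStarSubalgebra : Set B) →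
        u n ∈ reducedCrossedProduct A.action (A.restrictRep π) by
    choose W hW hmem using h
    refine ⟨⋃ n, W n, Set.countable_iUnion hW, fun A hA => ?_⟩
    exact (NonUnitalStarSubalgebra.isClosed_topologicalClosure _).mem_of_tendsto hlim
      (Eventually.of_forall fun n => hmem n A ((Set.subset_iUnion W n).trans hA))
  intro n
  refine NonUnitalStarAlgebra.adjoin_induction ℂ (p := fun T _ => ∃ W : Set B, W.Countable ∧
    ∀ A : InvariantSubalgebra α, W ⊆ (A.toNonUnitalStarSubalgebra : Set B) →
      T ∈ reducedCrossedProduct A.action (A.restrictRep π)) ?_ ?_ ?_ ?_ ?_ ?_ (hu n)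
  · rintro _ ⟨b, s, rfl⟩
    refine ⟨{b}, Set.countable_singleton b, fun A hA => ?_⟩
    exact NonUnitalStarSubalgebra.le_topologicalClosure _
      (NonUnitalStarAlgebra.subset_adjoin ℂ _ ⟨⟨b, hA rfl⟩, s, rfl⟩)
  · rintro x y _ _ ⟨V, hV, hx⟩ ⟨W, hW, hy⟩
    exact ⟨V ∪ W, hV.union hW, fun A hA => add_mem (hx A (Set.subset_union_left.trans hA))
      (hy A (Set.subset_union_right.trans hA))⟩
  · exact ⟨∅, Set.countable_empty, fun A _ => zero_mem _⟩
  · rintro x y _ _ ⟨V, hV, hx⟩ ⟨W, hW, hy⟩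
    exact ⟨V ∪ W, hV.union hW, fun A hA => mul_mem (hx A (Set.subset_union_left.trans hA))
      (hy A (Set.subset_union_right.trans hA))⟩
  · rintro c x _ ⟨W, hW, hx⟩
    exact ⟨W, hW, fun A hA => SMulMemClass.smul_mem c (hx A hA)⟩
  · rintro x _ ⟨W, hW, hx⟩
    exact ⟨W, hW, fun A hA => star_mem (hx A hA)⟩

/-- Proper infiniteness of `b` in a reduced crossed product is witnessed by countably many
coefficients. -/
theorem exists_countable_isProperlyInfinite (α : G →* (B ≃⋆ₐ[ℂ] B))
    (π : B →⋆ₙₐ[ℂ] (H →L[ℂ] H)) (b : B) :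
    ∃ W : Set B, W.Countable ∧ ∀ (A : InvariantSubalgebra α) (a : A.toNonUnitalStarSubalgebra),
      (a : B) = b → W ⊆ (A.toNonUnitalStarSubalgebra : Set B) →
        IsProperlyInfinite (inclusion α π (a : B)) →
          IsProperlyInfinite (inclusion A.action (A.restrictRep π) a) := by
  by_cases hb : IsProperlyInfinite (inclusion α π b)
  · obtain ⟨hne, r, hr⟩ := hb
    choose W hW hmem using fun k i j => exists_countable_support π (r k i j).2
    refine ⟨⋃ k, ⋃ i, ⋃ j, W k i j, Set.countable_iUnion fun k => Set.countable_iUnion fun i =>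
      Set.countable_iUnion fun j => hW k i j, ?_⟩
    rintro A a rfl hA -
    have hsub : ∀ k i j, (r k i j : ℓ²(G, H) →L[ℂ] ℓ²(G, H)) ∈
        reducedCrossedProduct A.action (A.restrictRep π) := fun k i j =>
      hmem k i j A (subset_trans (fun x hx => Set.mem_iUnion.2
        ⟨k, Set.mem_iUnion.2 ⟨i, Set.mem_iUnion.2 ⟨j, hx⟩⟩⟩) hA)
    have hle := A.reducedCrossedProduct_le π
    exact IsProperlyInfinite.of_map (NonUnitalStarSubalgebra.inclusion hle)
      (Topology.IsEmbedding.inclusion (SetLike.coe_subset_coe.2 hle)).isInducing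
      (map_zero (NonUnitalStarSubalgebra.inclusion hle))
      (map_mul (NonUnitalStarSubalgebra.inclusion hle))
      (map_star (NonUnitalStarSubalgebra.inclusion hle))
      hne (fun k i j => ⟨⟨r k i j, hsub k i j⟩, rfl⟩) hr
  -- Here the implication is vacuous, so `W` is defined for every `b` without assuming proper
  -- infiniteness.
  · refine ⟨∅, Set.countable_empty, ?_⟩
    rintro A a rfl _ h
    exact absurd h hb

end Invariant

/-! ### Invariant subalgebras as closures of countable sets -/

section Closure

variable {G : Type*} [Group G] {B : Type*} [NonUnitalCStarAlgebra B]

/-- The closure of a set that is closed under the algebraic operations, under multiplication by a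
dense set of scalars, and under the action is an invariant subalgebra. -/
theorem InvariantSubalgebra.exists_coe_eq_closure (α : G →* (B ≃⋆ₐ[ℂ] B)) {S : Set B} {C : Set ℂ}
    (hC : Dense C) (zero : (0 : B) ∈ S) (add : ∀ x ∈ S, ∀ y ∈ S, x + y ∈ S)
    (mul : ∀ x ∈ S, ∀ y ∈ S, x * y ∈ S) (star : ∀ x ∈ S, star x ∈ S)
    (smul : ∀ c ∈ C, ∀ x ∈ S, c • x ∈ S) (map : ∀ t, ∀ x ∈ S, α t x ∈ S) :
    ∃ A : InvariantSubalgebra α, (A.toNonUnitalStarSubalgebra : Set B) = closure S :=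
  ⟨{ carrier := closure S
     zero_mem' := subset_closure zero
     add_mem' := fun hx hy => map_mem_closure₂ continuous_add hx hy add
     mul_mem' := fun hx hy => map_mem_closure₂ continuous_mul hx hy mul
     star_mem' := fun hx => map_mem_closure continuous_star hx star
     smul_mem' := fun c _ hx => map_mem_closure₂ continuous_smul (hC c) hx smul
     isClosed' := isClosed_closure
     map_mem' := fun t _ hx => map_mem_closure
       (AddMonoidHomClass.continuous_of_bound (α t) 1 fun x => by
         simpa using NonUnitalStarAlgHom.norm_apply_le (α t) x) hx (map t) }, rfl⟩

/-- Every countable set generates, under the action and a countably-valued operation `Ψ`, a separable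
invariant subalgebra with a dense countable set that is closed under `Ψ`. -/
theorem InvariantSubalgebra.exists_countable_dense [Countable G] (α : G →* (B ≃⋆ₐ[ℂ] B)) {N : Set B}
    (hN : N.Countable) (Ψ : B → Set B) (hΨ : ∀ x, (Ψ x).Countable) :
    ∃ (A : InvariantSubalgebra α) (S : Set B), N ⊆ S ∧ S.Countable ∧
      (A.toNonUnitalStarSubalgebra : Set B) = closure S ∧ ∀ x ∈ S, Ψ x ⊆ S := by
  obtain ⟨C, hCc, hC⟩ := TopologicalSpace.exists_countable_dense ℂ
  -- All operations are packed into one set-valued binary map; the unary ones ignore `y` and are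
  -- recovered below by taking `y = x`.
  obtain ⟨S, hNS, hSc, hS⟩ := (hN.insert 0).exists_closed_superset
    (fun x y : B => {x + y, x * y, star x} ∪ ((fun c : ℂ => c • x) '' C ∪
      (Set.range (fun t => α t x) ∪ Ψ x)))
    (fun x y => (Set.toFinite _).countable.union ((hCc.image _).union
      ((Set.countable_range _).union (hΨ x))))
  obtain ⟨A, hA⟩ := InvariantSubalgebra.exists_coe_eq_closure α hC
    (hNS (Set.mem_insert _ _))
    (fun x hx y hy => hS x hx y hy (by simp))
    (fun x hx y hy => hS x hx y hy (by simp))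
    (fun x hx => hS x hx x hx (by simp))
    (fun c hc x hx => hS x hx x hx (Or.inr (Or.inl ⟨c, hc, rfl⟩)))
    (fun t x hx => hS x hx x hx (Or.inr (Or.inr (Or.inl ⟨t, rfl⟩))))
  exact ⟨A, S, (Set.subset_insert _ _).trans hNS, hSc, hA,
    fun x hx y hy => hS x hx x hx (Or.inr (Or.inr (Or.inr hy)))⟩

end Closure

/-! ### Approximation by projections in `ℓ^∞` -/

section Linfty

variable {G : Type*}

/-- The indicator function of the preimage of `U` under `f ∈ ℓ^∞(G)`. -/
noncomputable def preimageIndicator (U : Set ℂ) (f : ℓ^∞(G, ℂ)) : ℓ^∞(G, ℂ) :=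
  ⟨fun s => U.indicator 1 (f s), memℓp_infty ⟨1, by
    rintro _ ⟨s, rfl⟩
    by_cases h : f s ∈ U <;> simp [h]⟩⟩

theorem preimageIndicator_apply (U : Set ℂ) (f : ℓ^∞(G, ℂ)) (s : G) :
    preimageIndicator U f s = U.indicator 1 (f s) := rfl

theorem isStarProjection_preimageIndicator (U : Set ℂ) (f : ℓ^∞(G, ℂ)) :
    IsStarProjection (preimageIndicator U f) := by
  refine ⟨?_, ?_⟩
  · ext s
    by_cases h : f s ∈ U <;> simp [preimageIndicator_apply, h]
  · ext s
    by_cases h : f s ∈ U <;> simp [preimageIndicator_apply, h]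

/-- The complex numbers `z` for which the real part of `n z` rounds to `j`. -/
def reBand (n : ℕ) (j : ℤ) : Set ℂ := {z | round (n * z.re) = j}

/-- The complex numbers `z` for which the imaginary part of `n z` rounds to `j`. -/
def imBand (n : ℕ) (j : ℤ) : Set ℂ := {z | round (n * z.im) = j}

/-- A projection near `f` is the indicator function of the set where the real part of `f` rounds
to one. -/
theorem preimageIndicator_eq_of_norm_sub_lt {p f : ℓ^∞(G, ℂ)} (hp : IsStarProjection p)
    (h : ‖p - f‖ < 1 / 2) : preimageIndicator (reBand 1 1) f = p := by
  ext s
  have hs : |(p s).re - (f s).re| < 1 / 2 := by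
    refine lt_of_le_of_lt ?_ h
    have := lp.norm_apply_le_norm ENNReal.top_ne_zero (p - f) s
    exact (Complex.abs_re_le_norm (p s - f s)).trans this
  have hidem : p s * p s = p s := congrArg (fun g : ℓ^∞(G, ℂ) => g s) hp.isIdempotentElem.eq
  rw [abs_lt] at hs
  rw [preimageIndicator_apply]
  -- The values of `p` are 0 or 1, and the strict bound 1/2 makes the real part of `f s` round to
  -- exactly that value.
  rcases IsIdempotentElem.iff_eq_zero_or_one.1 hidem with h0 | h1
  · rw [h0] at hs ⊢
    refine Set.indicator_of_notMem ?_ _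
    simp only [reBand, Set.mem_ofPred_eq, round_eq, Int.floor_eq_iff]
    intro hf
    norm_num at hs hf
    linarith
  · rw [h1] at hs ⊢
    refine Set.indicator_of_mem ?_ _
    simp only [reBand, Set.mem_ofPred_eq, round_eq, Int.floor_eq_iff]
    norm_num at hs ⊢
    constructor <;> linarith

/-- Only the term `j = round (n * x)` survives. The `+ 1` in `hK` absorbs the rounding error of at
most 1/2, so this index lies in the range of summation. -/
theorem sum_indicator_round {K : ℤ} {M : ℝ} {n : ℕ} {x : ℝ} (hx : |x| ≤ M) (hK : n * M + 1 ≤ K) :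
    ∑ j ∈ Finset.Icc (-K) K, ((j : ℂ) / n) * (if round (n * x) = j then 1 else 0) =
      ((round (n * x) : ℝ) / n : ℝ) := by
  have hr := abs_sub_round (n * x : ℝ)
  have hn : |n * x| ≤ n * M := by
    rw [abs_mul, Nat.abs_cast]; gcongr
  have hmem : round (n * x) ∈ Finset.Icc (-K) K := by
    rw [abs_le] at hr hn
    rw [Finset.mem_Icc]
    constructor
    · have : ((-K : ℤ) : ℝ) ≤ round (n * x) := by push_cast; linarith
      exact_mod_cast this
    · have : (round (n * x) : ℝ) ≤ K := by linarith
      exact_mod_cast this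
  simp only [mul_ite, mul_one, mul_zero, Finset.sum_ite_eq, hmem, if_true]
  push_cast
  rfl

theorem abs_sub_round_div_le {n : ℕ} (hn : 0 < n) (x : ℝ) :
    |x - round (n * x) / n| ≤ 1 / (2 * n) := by
  have hn' : (0 : ℝ) < n := by exact_mod_cast hn
  have h := abs_sub_round (n * x : ℝ)
  have : x - round (n * x) / n = (n * x - round (n * x)) / n := by field_simp
  rw [this, abs_div, Nat.abs_cast, div_le_div_iff₀ hn' (by positivity)]
  nlinarith

/-- A closed subalgebra containing the indicator functions of the bands of `f` contains `f`. -/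
theorem mem_of_preimageIndicator_mem {P : NonUnitalStarSubalgebra ℂ ℓ^∞(G, ℂ)}
    (hP : IsClosed (P : Set ℓ^∞(G, ℂ))) {f : ℓ^∞(G, ℂ)}
    (hre : ∀ n j, preimageIndicator (reBand n j) f ∈ P)
    (him : ∀ n j, preimageIndicator (imBand n j) f ∈ P) : f ∈ P := by
  rw [← SetLike.mem_coe, ← hP.closure_eq, Metric.mem_closure_iff]
  intro ε hε
  obtain ⟨m, hm⟩ := exists_nat_one_div_lt hε
  set n := m + 1 with hn
  obtain ⟨K, hK⟩ := exists_int_ge (n * ‖f‖ + 1)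
  let g : ℓ^∞(G, ℂ) := ∑ j ∈ Finset.Icc (-K) K, ((j : ℂ) / n) • preimageIndicator (reBand n j) f +
    Complex.I • ∑ j ∈ Finset.Icc (-K) K, ((j : ℂ) / n) • preimageIndicator (imBand n j) f
  refine ⟨g, ?_, ?_⟩
  · exact add_mem (sum_mem fun j _ => SMulMemClass.smul_mem _ (hre n j))
      (SMulMemClass.smul_mem _ (sum_mem fun j _ => SMulMemClass.smul_mem _ (him n j)))
  · rw [dist_eq_norm]
    -- The real and imaginary parts each contribute an error of at most 1/(2n), for a total of 1/n <
    -- ε.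
    refine lt_of_le_of_lt (lp.norm_le_of_forall_le (by positivity) fun s => ?_)
      (by simpa [hn] using hm : 1 / (n : ℝ) < ε)
    have hs := lp.norm_apply_le_norm ENNReal.top_ne_zero f s
    have hg : g s = ((round (n * (f s).re) : ℝ) / n : ℝ) +
        Complex.I * ((round (n * (f s).im) : ℝ) / n : ℝ) := by
      rw [← sum_indicator_round ((Complex.abs_re_le_norm _).trans hs) hK,
        ← sum_indicator_round ((Complex.abs_im_le_norm _).trans hs) hK]
      simp only [g, lp.coeFn_add, Pi.add_apply, lp.coeFn_smul, Pi.smul_apply, lp.coeFn_sum,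
        Finset.sum_apply, preimageIndicator_apply, smul_eq_mul, Set.indicator_apply, reBand,
        imBand, Set.mem_ofPred_eq, Pi.one_apply]
    have hsub : (f - g) s = f s - g s := rfl
    refine (Complex.norm_le_abs_re_add_abs_im _).trans ?_
    rw [hsub, hg]
    have h1 := abs_sub_round_div_le (Nat.succ_pos m) (f s).re
    have h2 := abs_sub_round_div_le (Nat.succ_pos m) (f s).im
    have h3 : 1 / (2 * (n : ℝ)) + 1 / (2 * n) = 1 / n := by
      have : (n : ℝ) ≠ 0 := by rw [hn]; positivity
      field_simp; norm_num
    rw [← h3]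
    simpa [-Complex.ofReal_div, n] using add_le_add h1 h2

end Linfty

end CrossedProducts

set_option maxHeartbeats 2000000 in
theorem mainTheorem9 {G : Type*} [Group G] [Countable G] (N : Set ℓ^∞(G, ℂ)) (hN : N.Countable) :
    ∃ A : CrossedProducts.InvariantSubalgebra (CrossedProducts.leftTranslation G),
      N ⊆ (A.toNonUnitalStarSubalgebra : Set ℓ^∞(G, ℂ)) ∧
      TopologicalSpace.SeparableSpace A.toNonUnitalStarSubalgebra ∧
      A.IsGeneratedByProjections ∧
      ∀ p : A.toNonUnitalStarSubalgebra, IsStarProjection p →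
        CrossedProducts.IsProperlyInfinite
          (CrossedProducts.inclusion (CrossedProducts.leftTranslation G) (CrossedProducts.mulRep G)
            (p : ℓ^∞(G, ℂ))) →
        CrossedProducts.IsProperlyInfinite
          (CrossedProducts.inclusion A.action (A.restrictRep (CrossedProducts.mulRep G)) p) := by
  -- `W` depends on the element alone and not on the subalgebra, so it can be fed into the
  -- construction of `A`.
  choose W hW hinf using exists_countable_isProperlyInfinite (leftTranslation G) (mulRep G)
  obtain ⟨A, S, hNS, hSc, hA, hS⟩ := InvariantSubalgebra.exists_countable_dense
    (leftTranslation G) hN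
    (fun x => Set.range (fun q : ℕ × ℤ => preimageIndicator (reBand q.1 q.2) x) ∪
      (Set.range (fun q : ℕ × ℤ => preimageIndicator (imBand q.1 q.2) x) ∪ W x))
    (fun x => (Set.countable_range _).union ((Set.countable_range _).union (hW x)))
  have hre : ∀ x ∈ S, ∀ n j, preimageIndicator (reBand n j) x ∈ S := fun x hx n j =>
    hS x hx (Or.inl ⟨(n, j), rfl⟩)
  have him : ∀ x ∈ S, ∀ n j, preimageIndicator (imBand n j) x ∈ S := fun x hx n j =>
    hS x hx (Or.inr (Or.inl ⟨(n, j), rfl⟩))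
  have hSA : S ⊆ (A.toNonUnitalStarSubalgebra : Set ℓ^∞(G, ℂ)) :=
    hA ▸ subset_closure
  refine ⟨A, hNS.trans hSA, ?_, ?_, ?_⟩
  · have hsep := hSc.isSeparable.closure
    rw [← hA] at hsep
    exact hsep.separableSpace
  · refine le_antisymm ?_ ?_
    · exact NonUnitalStarSubalgebra.topologicalClosure_minimal _
        (NonUnitalStarAlgebra.adjoin_le fun p hp => hp.1) A.isClosed'
    · rw [← SetLike.coe_subset_coe, hA]
      refine closure_minimal (fun x hx => ?_)
        (NonUnitalStarSubalgebra.isClosed_topologicalClosure _)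
      refine mem_of_preimageIndicator_mem
        (NonUnitalStarSubalgebra.isClosed_topologicalClosure _) (fun n j => ?_) fun n j => ?_
      · exact NonUnitalStarSubalgebra.le_topologicalClosure _ (NonUnitalStarAlgebra.subset_adjoin
          ℂ _ ⟨hSA (hre x hx n j), isStarProjection_preimageIndicator _ _⟩)
      · exact NonUnitalStarSubalgebra.le_topologicalClosure _ (NonUnitalStarAlgebra.subset_adjoin
          ℂ _ ⟨hSA (him x hx n j), isStarProjection_preimageIndicator _ _⟩)
  · intro p hp hpi
    -- Membership in `S` itself, not merely in its closure, is needed, since only `S` is closed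
    -- under `W`.
    have hpS : (p : ℓ^∞(G, ℂ)) ∈ S := by
      obtain ⟨f, hf, hpf⟩ := Metric.mem_closure_iff.1 (hA ▸ p.2 : (p : ℓ^∞(G, ℂ)) ∈ closure S)
        (1 / 2) (by norm_num)
      rw [dist_eq_norm] at hpf
      have hp' : IsStarProjection (p : ℓ^∞(G, ℂ)) :=
        ⟨congrArg Subtype.val hp.isIdempotentElem.eq, congrArg Subtype.val hp.isSelfAdjoint.star_eq⟩
      rw [← preimageIndicator_eq_of_norm_sub_lt hp' hpf]
      exact hre f hf 1 1
    refine hinf p A p rfl (subset_trans (fun x hx => ?_) hSA) hpi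
    exact hS p hpS (Or.inr (Or.inr hx))
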